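/- **Setting.** Let $f\ge 0$, $n=3f+1$, $h=2f+1$. Of the $n$ players at most $k$ are rational and at most $t$ are Byzantine (together: the coalition, with bound $C=k+t$); the others are correct. They run the commit–reveal phase of TRAP (BFTCR), with symbolic encryption and unforgeable signatures. Every player enters with a predecision, and a correct player signs only for its own predecision. Every player $p_i$ commits, in a first broadcast RB1, either the encrypted hash of its predecision or an encrypted bundle of proofs of fraud (PoFs). After delivering at least $h$ commitments it broadcasts once, in RB2, the list of the commitments it has delivered. After delivering at least $h$ lists it reveals its key. The scheduler is asynchronous. Coalition members deviate arbitrarily, also inside the two broadcasts (different signed messages to different players, selective delivery, fabricated lists), but cannot forge signatures. A PoF bundle is valid if it proves, by pairs of conflicting signatures, that at least $f+1$ players have signed two different values. A *fork* consists of $a\ge 2$ branches with distinct values. Every correct player belongs to the branch of its predecision. Each branch has a quorum of at least $h$ players that signed for its value, and every correct player of the branch has broadcast an RB2 list that contains an RB1 commitment of each member of this quorum. A set $E$ of *detected equivocators* is a set of at least $f+1$ players each of which has signed two different values. A player $p_j$ is a *valid candidate* (relative to $E$) if it has revealed a ciphertext that decrypts to a valid PoF bundle and there is a set $Q$ of at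 least $f+1$ players outside $E$, each of which has broadcast an RB2 list containing this ciphertext as the commitment of $p_j$. A *baiter* in a fork is a rational player that takes part in the fork as an equivocator (it is in the quorum of every branch) and whose only RB1 commitment is an encrypted valid PoF bundle. A player *has committed PoFs in RB1* if some correct player has delivered from its RB1 a ciphertext that decrypts to a valid PoF bundle. **Statement.** 1. In every fork, the players in the quorums of two different branches are at least $f+1$ detected equivocators, all of them in the coalition. 2. Suppose $C\le\lfloor(5f+2)/3\rfloor$ and $t\le f$; this holds in particular if $n>\max\left(3t,\tfrac{9(k+t)}5\right)$. Then in every execution and for every set $E$ of detected equivocators: (i) in a fork, every baiter is a valid candidate once it has revealed (for this part a coalition of at most $2f$ players, i.e. at least $f+1$ correct players, is enough); (ii) a player that has not committed PoFs in RB1 is not a valid candidate, whatever the coalition does; (iii) the winner consensus among the $n'=n-|E|$ residual players is feasible: the number $C'$ of residual coalition members satisfies $C'<n'/3$ (where $n'\le 2f$). Neither $n>2(k+t)$ nor $n>\tfrac32k+3t$ nor $t<2f/3$ is assumed. 3. Late commitments: if a player has delivered at least $h$ RB2 lists, none of which contains a given commitment of $p_j$, then at most $f$ of all the lists it ever delivers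 contain that commitment. 4. For integers $C\ge0$: $C\le\lfloor(5f+2)/3\rfloor$ if and only if $C-(f+1)<2f/3$, and this implies $C\le 2f$. Moreover $n>\max(3t,\,9(k+t)/5)$ if and only if $k+t\le\lfloor(5f+2)/3\rfloor$, $t\le f$ and $3(k+t)\ne 5f+2$. 5. The original condition $n>\max(\tfrac32k+3t,\,2(k+t))$ is equivalent to $k+t<n/2$ if $k\ge 2t$ and to $k+t<2n/3-t$ if $k\le 2t$, and it implies $n>\max(3t,\,9(k+t)/5)$. The coalition sizes $C=k+t$ that occur under the original condition are exactly those with $C<n/2$; those that occur under $n>\max(3t,\,9(k+t)/5)$ are exactly those with $C<5n/9$. For $n\ge 10$ there is an integer $C$ with $n/2\le C<5n/9$. -/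

import Mathlib

namespace Trap

universe u

/-! ## Players, thresholds and symbolic cryptography -/

/-- The three types of players. -/
inductive Role where
  | correct
  | rational
  | byzantine

/-- The `n = 3 f + 1` players. -/
abbrev Player (f : ℕ) : Type := Fin (3 * f + 1)

/-- The quorum `h = 2 f + 1`. -/
def quorum (f : ℕ) : ℕ := 2 * f + 1

/-- A proof of fraud: the claim that `culprit` has signed two conflicting values. -/
structure PoF (f : ℕ) (V : Type u) where
  culprit : Player f
  fst : V
  snd : V

/-- What a commitment may contain: the hash of a value (hashing is injective, so the value itself
stands for its hash), or a finite bundle of proofs of fraud. -/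
inductive Plaintext (f : ℕ) (V : Type u) where
  | hash (v : V)
  | pofs (B : List (PoF f V))

/-- A ciphertext `Enc(k_i, m)` with `i = key`, `m = plain` and encryption randomness `nonce`. -/
structure Ciphertext (f : ℕ) (V : Type u) where
  key : Player f
  nonce : ℕ
  plain : Plaintext f V

/-- The payload of the second broadcast: for each player, the commitment (if any) that was
delivered from that player's first broadcast. -/
abbrev CommitList (f : ℕ) (V : Type u) : Type u := Player f → Option (Ciphertext f V)

/-! ## The commit-reveal protocol -/

/-- A global state of one instance of the commit-reveal protocol.
* `signed p`: the values for which `p` has signed its (finalization) vote;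
* `sent1 p`: the commitments that `p` has signed and input to its first broadcast RB1;
* `rb1 p j`: the commitment that `p` has delivered from the RB1 of `j`;
* `sent2 p`: the lists that `p` has signed and input to its second broadcast RB2;
* `rb2 p q`: the list that `p` has delivered from the RB2 of `q`;
* `revealed`: the players that have released their decryption key. -/
@[ext]
structure State (f : ℕ) (V : Type u) where
  signed : Player f → Set V
  sent1 : Player f → Set (Ciphertext f V)
  rb1 : Player f → CommitList f V
  sent2 : Player f → Set (CommitList f V)
  rb2 : Player f → Player f → Option (CommitList f V)
  revealed : Set (Player f)

variable {f : ℕ} {V : Type u}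

/-- The initial state: nothing has happened. -/
def State.init : State f V where
  signed _ := ∅
  sent1 _ := ∅
  rb1 _ _ := none
  sent2 _ := ∅
  rb2 _ _ := none
  revealed := ∅

open Classical in
/-- The players accused by a bundle. -/
noncomputable def culprits (B : List (PoF f V)) : Finset (Player f) :=
  Finset.univ.filter fun j => ∃ π ∈ B, π.culprit = j

/-- A bundle is valid if each of its proofs consists of two conflicting values that the culprit has
really signed (signatures are unforgeable), and it convicts at least `f + 1` players. -/
def ValidBundle (s : State f V) (B : List (PoF f V)) : Prop :=
  (∀ π ∈ B, π.fst ≠ π.snd ∧ π.fst ∈ s.signed π.culprit ∧ π.snd ∈ s.signed π.culprit) ∧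
    f + 1 ≤ (culprits B).card

/-- With the key of `j`, the ciphertext `c` decrypts to a valid bundle of proofs of fraud. -/
def OpensToPoFs (s : State f V) (j : Player f) (c : Ciphertext f V) : Prop :=
  c.key = j ∧ ∃ B, c.plain = Plaintext.pofs B ∧ ValidBundle s B

open Classical in
/-- The number of commitments that `p` has delivered. -/
noncomputable def rb1Count (s : State f V) (p : Player f) : ℕ :=
  (Finset.univ.filter fun j => s.rb1 p j ≠ none).card

open Classical in
/-- The number of lists that `p` has delivered. -/
noncomputable def rb2Count (s : State f V) (p : Player f) : ℕ :=
  (Finset.univ.filter fun q => s.rb2 p q ≠ none).card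

open Classical in
/-- One step of the protocol, where `role` gives the types of the players and `pre p` is the
predecision with which `p` enters. The scheduler chooses the steps. Correct players follow the
protocol; the others (the coalition) are unrestricted, except that they cannot forge signatures.
In particular the two broadcasts deliver what the sender has signed, and at most one message per
sender, but if the sender is in the coalition it may sign several messages, and then nothing forces
different players to deliver the same one, or to deliver at all: this covers every deviation of the
coalition from the reliable broadcast protocols. -/
inductive Step (role : Player f → Role) (pre : Player f → V) : State f V → State f V → Prop where
  /-- `p` signs a vote for `v`; a correct player only votes for its predecision. -/
  | sign (s : State f V) (p : Player f) (v : V)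
      (hp : role p = Role.correct → v = pre p) :
      Step role pre s
        { s with signed := Function.update s.signed p (insert v (s.signed p)) }
  /-- `p` starts RB1 with `c`; a correct player does so once, with its encrypted predecision
  hash or with encrypted valid proofs of fraud. -/
  | commit (s : State f V) (p : Player f) (c : Ciphertext f V)
      (hp : role p = Role.correct → s.sent1 p = ∅ ∧ c.key = p ∧
        (c.plain = Plaintext.hash (pre p) ∨ OpensToPoFs s p c)) :
      Step role pre s
        { s with sent1 := Function.update s.sent1 p (insert c (s.sent1 p)) }
  /-- `p` delivers `c` from the RB1 of `j`. -/
  | deliver1 (s : State f V) (p j : Player f) (c : Ciphertext f V)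
      (hc : c ∈ s.sent1 j) (hnew : s.rb1 p j = none) :
      Step role pre s
        { s with rb1 := Function.update s.rb1 p (Function.update (s.rb1 p) j (some c)) }
  /-- `p` starts RB2 with the list `L`; a correct player does so once, after at least `2 f + 1`
  deliveries from RB1, with the list of what it has delivered. -/
  | list (s : State f V) (p : Player f) (L : CommitList f V)
      (hp : role p = Role.correct → s.sent2 p = ∅ ∧ L = s.rb1 p ∧ quorum f ≤ rb1Count s p) :
      Step role pre s
        { s with sent2 := Function.update s.sent2 p (insert L (s.sent2 p)) }
  /-- `p` delivers `L` from the RB2 of `q`. -/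
  | deliver2 (s : State f V) (p q : Player f) (L : CommitList f V)
      (hL : L ∈ s.sent2 q) (hnew : s.rb2 p q = none) :
      Step role pre s
        { s with rb2 := Function.update s.rb2 p (Function.update (s.rb2 p) q (some L)) }
  /-- `p` releases its decryption key; a correct player does so only after `2 f + 1` deliveries
  from RB1 and `2 f + 1` deliveries from RB2. -/
  | reveal (s : State f V) (p : Player f)
      (hp : role p = Role.correct → quorum f ≤ rb2Count s p ∧ quorum f ≤ rb1Count s p) :
      Step role pre s { s with revealed := insert p s.revealed }

/-- `s'` can be reached from `s`. -/
def Reaches (role : Player f → Role) (pre : Player f → V) (s s' : State f V) : Prop :=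
  Relation.ReflTransGen (Step role pre) s s'

/-- `s` is the state after some finite execution. -/
def Reachable (role : Player f → Role) (pre : Player f → V) (s : State f V) : Prop :=
  Reaches role pre State.init s

/-! ## Coalition, equivocators, forks -/

open Classical in
/-- The rational players. -/
noncomputable def rationals (role : Player f → Role) : Finset (Player f) :=
  Finset.univ.filter fun p => role p = Role.rational

open Classical in
/-- The Byzantine players. -/
noncomputable def byzantines (role : Player f → Role) : Finset (Player f) :=
  Finset.univ.filter fun p => role p = Role.byzantine

/-- The coalition: all rational and all Byzantine players. -/
noncomputable def coalition (role : Player f → Role) : Finset (Player f) :=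
  rationals role ∪ byzantines role

/-- `E` is a set of at least `f + 1` players, each of which has signed two conflicting values:
these players can be detected as equivocators from their signatures. -/
def DetectedEquivocators (s : State f V) (E : Finset (Player f)) : Prop :=
  (∀ j ∈ E, ∃ v ∈ s.signed j, ∃ w ∈ s.signed j, v ≠ w) ∧ f + 1 ≤ E.card

/-- The execution has forked into `a` branches. Branch `b` is for the value `value b`, and its
correct players are those that entered with this predecision; every correct player is in some
branch. Branch `b` has reached quorum: its quorum `S b` consists of at least `2 f + 1` players that
have signed for `value b`, and the correct players of the branch have started RB2 on the RB1
messages of this quorum. -/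
structure IsFork (role : Player f → Role) (pre : Player f → V) (s : State f V) {a : ℕ}
    (value : Fin a → V) (S : Fin a → Finset (Player f)) : Prop where
  two_le : 2 ≤ a
  value_injective : Function.Injective value
  correct_mem : ∀ p, role p = Role.correct → ∃ b, pre p = value b
  card_quorum : ∀ b, quorum f ≤ (S b).card
  signed_quorum : ∀ b, ∀ j ∈ S b, value b ∈ s.signed j
  list_quorum : ∀ b p, role p = Role.correct → pre p = value b →
    ∃ L ∈ s.sent2 p, ∀ j ∈ S b, L j ≠ none

open Classical in
/-- The equivocators detected in a fork: the players in the intersection of the quorums of two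
different branches. -/
noncomputable def forkEquivocators {a : ℕ} (S : Fin a → Finset (Player f)) : Finset (Player f) :=
  Finset.univ.filter fun j => ∃ b b', b ≠ b' ∧ j ∈ S b ∧ j ∈ S b'

/-! ## Valid candidates -/

/-- `j` is a valid candidate, relative to the set `E` of detected equivocators: it has revealed a
ciphertext that decrypts to a valid bundle of proofs of fraud, and at least `f + 1` players outside
`E` have broadcast an RB2 list that contains this ciphertext as the commitment of `j`. -/
def ValidCandidate (s : State f V) (E : Finset (Player f)) (j : Player f) : Prop :=
  j ∈ s.revealed ∧ ∃ c, OpensToPoFs s j c ∧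
    ∃ Q : Finset (Player f), Disjoint Q E ∧ f + 1 ≤ Q.card ∧
      ∀ q ∈ Q, ∃ L ∈ s.sent2 q, L j = some c

/-- `j` plays the baiting strategy in a fork: it is a rational player that takes part in the fork
as an equivocator (it belongs to the quorum of every branch), and what it commits to in RB1 is
(only) an encrypted valid bundle of proofs of fraud. -/
def IsBaiter (role : Player f → Role) (s : State f V) {a : ℕ} (S : Fin a → Finset (Player f))
    (j : Player f) : Prop :=
  role j = Role.rational ∧ (∀ b, j ∈ S b) ∧ ∃ c, s.sent1 j = {c} ∧ OpensToPoFs s j c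

/-- `j` has committed proofs of fraud in RB1: at least one correct player has delivered from the
RB1 of `j` a commitment which decrypts to a valid bundle. -/
def CommittedPoFs (role : Player f → Role) (s : State f V) (j : Player f) : Prop :=
  ∃ p, role p = Role.correct ∧ ∃ c, s.rb1 p j = some c ∧ OpensToPoFs s j c

/-- Valid-candidacy, first part: in every fork, every baiter is a valid candidate as soon as it
has revealed, whichever set `E` of detected equivocators is excluded (for instance
`forkEquivocators S`). -/
def BaitersAreCandidates (role : Player f → Role) (pre : Player f → V) : Prop :=
  ∀ s, Reachable role pre s → ∀ (a : ℕ) (value : Fin a → V) (S : Fin a → Finset (Player f)),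
    IsFork role pre s value S → ∀ E, DetectedEquivocators s E →
      ∀ j, IsBaiter role s S j → j ∈ s.revealed → ValidCandidate s E j

/-- Valid-candidacy, second part: a player that has not committed proofs of fraud in RB1 is not a
valid candidate, whatever the coalition does. -/
def NonBaitersAreNotCandidates (role : Player f → Role) (pre : Player f → V) : Prop :=
  ∀ s, Reachable role pre s → ∀ E, DetectedEquivocators s E →
    ∀ j, ¬ CommittedPoFs role s j → ¬ ValidCandidate s E j

/-- The winner consensus, which is a partially synchronous Byzantine consensus among the players
that remain when detected equivocators are excluded, is feasible: fewer than a third of these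
players are in the coalition. -/
def WinnerConsensusFeasible (role : Player f → Role) (pre : Player f → V) : Prop :=
  ∀ s, Reachable role pre s → ∀ E, DetectedEquivocators s E →
    3 * (coalition role \ E).card < (Finset.univ \ E).card

variable (V) in
/-- All coalitions of at most `k` rational and at most `t` Byzantine players are tolerated:
valid-candidacy holds and the winner consensus is feasible. -/
def Tolerates (f k t : ℕ) : Prop :=
  ∀ (role : Player f → Role) (pre : Player f → V),
    (rationals role).card ≤ k → (byzantines role).card ≤ t →
      BaitersAreCandidates role pre ∧ NonBaitersAreNotCandidates role pre ∧
        WinnerConsensusFeasible role pre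

/-! ## The bounds -/

/-- The original condition `n > max (3 k / 2 + 3 t, 2 (k + t))`. -/
def OriginalBound (n k t : ℕ) : Prop :=
  (n : ℝ) > max (3 / 2 * (k : ℝ) + 3 * t) (2 * ((k : ℝ) + t))

/-- The relaxed condition `n > max (3 t, 9 (k + t) / 5)`. -/
def RelaxedBound (n k t : ℕ) : Prop :=
  (n : ℝ) > max (3 * (t : ℝ)) (9 * ((k : ℝ) + t) / 5)

/-- The winner consensus window `k + t ≤ ⌊(5 f + 2) / 3⌋` and `t ≤ f` (the division is the
floor division of natural numbers). -/
def Window (f k t : ℕ) : Prop :=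
  k + t ≤ (5 * f + 2) / 3 ∧ t ≤ f

end Trap

namespace Trap

variable {f : ℕ} {V : Type*} {role : Player f → Role} {pre : Player f → V} {s s' : State f V}

/-! ## Invariants of executions -/

/-! Three invariants turn the protocol into counting. A correct player never signs two values, so a
set `E` of detected equivocators lies in the coalition. RB1 delivers only what its sender signed,
and a correct player's RB2 list holds only its own RB1 deliveries.

In a fork, every correct list contains the baiter's only commitment, and the correct players, at
least `f + 1` of them and all outside `E`, form the required `Q`. Conversely, `E` uses up `f + 1`
coalition members, so the few left cannot fill a `Q` outside `E`: some correct player vouches for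
the ciphertext.

For the winner consensus, put `e = E.card`. The condition `3 * (C - e) < 3 * f + 1 - e` reads `3 * C
< 3 * f + 1 + 2 * e`. It is hardest at `e = f + 1`, where it becomes `C ≤ (5 * f + 2) / 3`. -/

theorem Step.rb1_mono (h : Step role pre s s') {p j : Player f} {c : Ciphertext f V}
    (hc : s.rb1 p j = some c) : s'.rb1 p j = some c := by
  cases h with
  | deliver1 q i d hd hnew =>
    by_cases hq : p = q
    · subst hq
      have hj : j ≠ i := by
        rintro rfl
        simp [hnew] at hc
      simpa [Function.update_of_ne hj] using hc
    · simpa [Function.update_of_ne hq] using hc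
  | _ => exact hc

theorem Step.rb2_mono (h : Step role pre s s') {p q : Player f} {L : CommitList f V}
    (hL : s.rb2 p q = some L) : s'.rb2 p q = some L := by
  cases h with
  | deliver2 p' q' L' hL' hnew =>
    by_cases hp : p = p'
    · subst hp
      have hq : q ≠ q' := by
        rintro rfl
        simp [hnew] at hL
      simpa [Function.update_of_ne hq] using hL
    · simpa [Function.update_of_ne hp] using hL
  | _ => exact hL

theorem Reaches.rb2_mono (h : Reaches role pre s s') {p q : Player f} {L : CommitList f V}
    (hL : s.rb2 p q = some L) : s'.rb2 p q = some L := by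
  induction h with
  | refl => exact hL
  | tail _ hstep ih => exact hstep.rb2_mono ih

/-- A correct player signs only for its predecision. -/
theorem Reachable.eq_pre_of_mem_signed (h : Reachable role pre s) {p : Player f}
    (hp : role p = Role.correct) {v : V} (hv : v ∈ s.signed p) : v = pre p := by
  induction h with
  | refl => simp [State.init] at hv
  | tail _ hstep ih =>
    cases hstep with
    | sign q w hq =>
      by_cases hpq : p = q
      · subst hpq
        rcases (by simpa using hv : v = w ∨ v ∈ _) with rfl | hv
        · exact hq hp
        · exact ih hv
      · exact ih (by simpa [Function.update_of_ne hpq] using hv)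
    | _ => exact ih hv

/-- RB1 delivers only what the sender has signed. -/
theorem Reachable.mem_sent1_of_rb1 (h : Reachable role pre s) {p j : Player f}
    {c : Ciphertext f V} (hc : s.rb1 p j = some c) : c ∈ s.sent1 j := by
  induction h with
  | refl => simp [State.init] at hc
  | tail _ hstep ih =>
    cases hstep with
    | commit q d hq =>
      by_cases hjq : j = q
      · subst hjq
        simpa using Or.inr (ih hc)
      · simpa [Function.update_of_ne hjq] using ih hc
    | deliver1 q i d hd hnew =>
      by_cases hpq : p = q
      · subst hpq
        by_cases hji : j = i
        · subst hji
          obtain rfl : d = c := by simpa using hc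
          exact hd
        · exact ih (by simpa [Function.update_of_ne hji] using hc)
      · exact ih (by simpa [Function.update_of_ne hpq] using hc)
    | _ => exact ih hc

/-- The RB2 list of a correct player contains only commitments that it has delivered from RB1. -/
theorem Reachable.rb1_of_mem_sent2 (h : Reachable role pre s) {p : Player f}
    (hp : role p = Role.correct) {L : CommitList f V} (hL : L ∈ s.sent2 p) {j : Player f}
    {c : Ciphertext f V} (hc : L j = some c) : s.rb1 p j = some c := by
  induction h with
  | refl => simp [State.init] at hL
  | tail _ hstep ih =>
    -- A list is frozen when sent while `rb1` keeps growing; monotonicity carries the claim across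
    -- later deliveries.
    have hmono := hstep.rb1_mono (p := p) (j := j) (c := c)
    cases hstep with
    | list q M hq =>
      by_cases hpq : p = q
      · subst hpq
        rcases (by simpa using hL : L = M ∨ L ∈ _) with rfl | hL
        · simpa [(hq hp).2.1] using hc
        · exact ih hL
      · exact ih (by simpa [Function.update_of_ne hpq] using hL)
    | _ => exact hmono (ih hL)

/-! ## Counting players -/

theorem mem_coalition {p : Player f} : p ∈ coalition role ↔ role p ≠ Role.correct := by
  cases h : role p <;> simp [coalition, rationals, byzantines, h]

theorem card_coalition_le {k t : ℕ} (hk : (rationals role).card ≤ k)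
    (ht : (byzantines role).card ≤ t) : (coalition role).card ≤ k + t :=
  (Finset.card_union_le _ _).trans (add_le_add hk ht)

theorem DetectedEquivocators.subset_coalition {E : Finset (Player f)}
    (hE : DetectedEquivocators s E) (h : Reachable role pre s) : E ⊆ coalition role := by
  intro j hj
  obtain ⟨v, hv, w, hw, hvw⟩ := hE.1 j hj
  exact mem_coalition.2 fun hc =>
    hvw ((h.eq_pre_of_mem_signed hc hv).trans (h.eq_pre_of_mem_signed hc hw).symm)

/-- Quorum intersection: two quorums overlap in at least `2 * (2 * f + 1) - (3 * f + 1) = f + 1`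
players, and distinct branches have distinct values. -/
theorem IsFork.detectedEquivocators {a : ℕ} {value : Fin a → V} {S : Fin a → Finset (Player f)}
    (hS : IsFork role pre s value S) : DetectedEquivocators s (forkEquivocators S) := by
  refine ⟨fun j hj => ?_, ?_⟩
  · obtain ⟨b, b', hne, hb, hb'⟩ := by simpa [forkEquivocators] using hj
    exact ⟨value b, hS.signed_quorum b j hb, value b', hS.signed_quorum b' j hb',
      hS.value_injective.ne hne⟩
  · let b : Fin a := ⟨0, by have := hS.two_le; omega⟩
    let b' : Fin a := ⟨1, by have := hS.two_le; omega⟩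
    have hne : b ≠ b' := by simp [b, b']
    have hsub : S b ∩ S b' ⊆ forkEquivocators S := fun j hj => by
      rw [Finset.mem_inter] at hj
      simpa [forkEquivocators] using ⟨b, b', hne, hj.1, hj.2⟩
    have h1 := Finset.card_le_card hsub
    have h2 := Finset.card_union_add_card_inter (S b) (S b')
    have h3 : (S b ∪ S b').card ≤ 3 * f + 1 := by simpa using Finset.card_le_univ (S b ∪ S b')
    have h4 := hS.card_quorum b
    have h5 := hS.card_quorum b'
    unfold quorum at h4 h5
    omega

/-! ## Valid candidates and the winner consensus -/

theorem baitersAreCandidates (hC : (coalition role).card ≤ 2 * f) :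
    BaitersAreCandidates role pre := by
  rintro s h a value S hS E hE j ⟨-, hjS, c, hsent, hopen⟩ hrev
  -- The witness `Q` is the set of all correct players.
  refine ⟨hrev, c, hopen, (coalition role)ᶜ, ?_, ?_, fun q hq => ?_⟩
  · exact disjoint_compl_left.mono_right (hE.subset_coalition h)
  · rw [Finset.card_compl, Fintype.card_fin]
    omega
  · have hq : role q = Role.correct := by simpa [mem_coalition] using hq
    obtain ⟨b, hb⟩ := hS.correct_mem q hq
    obtain ⟨L, hL, hLS⟩ := hS.list_quorum b q hq hb
    obtain ⟨d, hd⟩ := Option.ne_none_iff_exists'.1 (hLS j (hjS b))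
    -- The baiter signed only `c`, so the entry `d` in this list can only be `c`.
    have hmem := h.mem_sent1_of_rb1 (h.rb1_of_mem_sent2 hq hL hd)
    rw [hsent, Set.mem_singleton_iff] at hmem
    exact ⟨L, hL, hmem ▸ hd⟩

theorem nonBaitersAreNotCandidates (hC : (coalition role).card ≤ 2 * f + 1) :
    NonBaitersAreNotCandidates role pre := by
  rintro s h E hE j hj ⟨-, c, hopen, Q, hQE, hQ, hlist⟩
  have hsub := hE.subset_coalition h
  obtain ⟨q, hq, hqC⟩ : ∃ q ∈ Q, q ∉ coalition role := by
    -- Otherwise the disjoint sets `Q` and `E` would put `2 * f + 2` players into the coalition.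
    by_contra! hcon
    have h1 := Finset.card_le_card (Finset.union_subset hcon hsub)
    rw [Finset.card_union_of_disjoint hQE] at h1
    have h2 := hE.2
    omega
  have hq' : role q = Role.correct := by simpa [mem_coalition] using hqC
  obtain ⟨L, hL, hLj⟩ := hlist q hq
  exact hj ⟨q, hq', c, h.rb1_of_mem_sent2 hq' hL hLj, hopen⟩

theorem winnerConsensusFeasible (hC : (coalition role).card ≤ (5 * f + 2) / 3) :
    WinnerConsensusFeasible role pre := by
  intro s h E hE
  have hsub := hE.subset_coalition h
  have h1 := Finset.card_le_card hsub
  have h2 := hE.2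
  rw [Finset.card_sdiff_of_subset hsub, Finset.card_sdiff_of_subset (Finset.subset_univ _),
    Finset.card_univ, Fintype.card_fin]
  omega

theorem Window.tolerates {k t : ℕ} (h : Window f k t) : Tolerates V f k t := by
  intro role pre hk ht
  have hC := (card_coalition_le hk ht).trans h.1
  -- Both size bounds follow from `(5 * f + 2) / 3 ≤ 2 * f`, since `5 * f + 2 < 3 * (2 * f + 1)`.
  exact ⟨baitersAreCandidates (by omega), nonBaitersAreNotCandidates (by omega),
    winnerConsensusFeasible hC⟩

/-! ## Late commitments -/

/-- Delivered lists are never replaced, so a list containing `c` must come from one of the at most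
`(3 * f + 1) - (2 * f + 1) = f` senders not yet heard. -/
theorem Reaches.card_le_of_late (h : Reaches role pre s s') {p j : Player f}
    {c : Ciphertext f V} (hcount : quorum f ≤ rb2Count s p)
    (hlate : ∀ q L, s.rb2 p q = some L → L j ≠ some c) {Q : Finset (Player f)}
    (hQ : ∀ q ∈ Q, ∃ L, s'.rb2 p q = some L ∧ L j = some c) : Q.card ≤ f := by
  classical
  unfold rb2Count quorum at hcount
  have hdisj : Disjoint Q (Finset.univ.filter fun q => s.rb2 p q ≠ none) := by
    rw [Finset.disjoint_left]
    intro q hq hq'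
    obtain ⟨L, hL⟩ := Option.ne_none_iff_exists'.1 (Finset.mem_filter.1 hq').2
    obtain ⟨M, hM, hMj⟩ := hQ q hq
    rw [h.rb2_mono hL, Option.some_inj] at hM
    exact hlate q L hL (hM ▸ hMj)
  have h1 := Finset.card_le_univ (Q ∪ Finset.univ.filter fun q => s.rb2 p q ≠ none)
  rw [Finset.card_union_of_disjoint hdisj, Fintype.card_fin] at h1
  omega

/-! ## The bounds in integer form -/

theorem relaxedBound_iff {n k t : ℕ} :
    RelaxedBound n k t ↔ 3 * t < n ∧ 9 * (k + t) < 5 * n := by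
  rw [RelaxedBound, gt_iff_lt, max_lt_iff, div_lt_iff₀ (by norm_num), mul_comm (n : ℝ)]
  norm_cast

theorem originalBound_iff {n k t : ℕ} :
    OriginalBound n k t ↔ 3 * k + 6 * t < 2 * n ∧ 2 * (k + t) < n := by
  have h : (3 / 2 * (k : ℝ) + 3 * t < n) ↔ 3 * (k : ℝ) + 6 * t < 2 * n := by
    constructor <;> intro h <;> linarith
  rw [OriginalBound, gt_iff_lt, max_lt_iff, h]
  norm_cast

/-- Over the integers `9 * C < 15 * f + 5` means `3 * C ≤ 5 * f + 1`, which misses only the window's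
boundary case `3 * C = 5 * f + 2`. -/
theorem relaxedBound_iff_window {k t : ℕ} :
    RelaxedBound (3 * f + 1) k t ↔ Window f k t ∧ 3 * (k + t) ≠ 5 * f + 2 := by
  rw [relaxedBound_iff, Window]
  omega

theorem cast_lt_half_iff {m n : ℕ} : (m : ℝ) < (n : ℝ) / 2 ↔ 2 * m < n := by
  rw [lt_div_iff₀ (by norm_num), mul_comm]
  norm_cast

theorem cast_lt_five_ninths_iff {m n : ℕ} : (m : ℝ) < 5 * (n : ℝ) / 9 ↔ 9 * m < 5 * n := by
  rw [lt_div_iff₀ (by norm_num), mul_comm]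
  norm_cast

theorem add_lt_two_thirds_sub_iff {n k t : ℕ} :
    (k : ℝ) + t < 2 * (n : ℝ) / 3 - t ↔ 3 * k + 6 * t < 2 * n := by
  have h : (k : ℝ) + t < 2 * (n : ℝ) / 3 - t ↔ 3 * (k : ℝ) + 6 * t < 2 * n := by
    constructor <;> intro h <;> linarith
  rw [h]
  norm_cast

theorem le_window_iff {C : ℕ} : C ≤ (5 * f + 2) / 3 ↔ (C : ℝ) - (f + 1) < 2 * f / 3 := by
  have h : (C : ℝ) - (f + 1) < 2 * f / 3 ↔ 3 * (C : ℝ) < 5 * f + 3 := by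
    constructor <;> intro h <;> linarith
  rw [h]
  norm_cast
  omega

end Trap

theorem mainTheorem9 {V : Type*} (f : ℕ) :
    -- In every fork, the quorum intersection detects `f + 1` equivocators, all in the coalition.
    (∀ (role : Trap.Player f → Trap.Role) (pre : Trap.Player f → V) (s : Trap.State f V),
      Trap.Reachable role pre s →
      ∀ (a : ℕ) (value : Fin a → V) (S : Fin a → Finset (Trap.Player f)),
        Trap.IsFork role pre s value S →
          Trap.DetectedEquivocators s (Trap.forkEquivocators S) ∧
            Trap.forkEquivocators S ⊆ Trap.coalition role) ∧
    -- Valid-candidacy (i) needs only `n - C ≥ f + 1`, that is, `C ≤ 2 f`.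
    (∀ (role : Trap.Player f → Trap.Role) (pre : Trap.Player f → V),
      (Trap.coalition role).card ≤ 2 * f → Trap.BaitersAreCandidates role pre) ∧
    -- Late commitments: if no RB2 list that `p` has delivered contains the commitment `c` of `j`
    -- when `p` has delivered `2 f + 1` lists, then at most `f` lists that `p` ever delivers do.
    (∀ (role : Trap.Player f → Trap.Role) (pre : Trap.Player f → V) (s s' : Trap.State f V),
      Trap.Reachable role pre s → Trap.Reaches role pre s s' →
      ∀ (p j : Trap.Player f) (c : Trap.Ciphertext f V),
        Trap.quorum f ≤ Trap.rb2Count s p →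
        (∀ q L, s.rb2 p q = some L → L j ≠ some c) →
        ∀ Q : Finset (Trap.Player f),
          (∀ q ∈ Q, ∃ L, s'.rb2 p q = some L ∧ L j = some c) → Q.card ≤ f) ∧
    -- Tolerance under the winner consensus conditions, and under the relaxed bound.
    (∀ k t : ℕ, Trap.Window f k t → Trap.Tolerates V f k t) ∧
    (∀ k t : ℕ, Trap.RelaxedBound (3 * f + 1) k t → Trap.Tolerates V f k t) ∧
    -- The window is the winner consensus condition `C - (f + 1) < 2 f / 3`, and gives `C ≤ 2 f`.
    (∀ C : ℕ, C ≤ (5 * f + 2) / 3 ↔ (C : ℝ) - (f + 1) < 2 * f / 3) ∧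
    (∀ C : ℕ, C ≤ (5 * f + 2) / 3 → C ≤ 2 * f) ∧
    -- The window in terms of `n`.
    (∀ k t : ℕ, Trap.RelaxedBound (3 * f + 1) k t ↔
      Trap.Window f k t ∧ 3 * (k + t) ≠ 5 * f + 2) ∧
    -- The original bound in its two ranges, and its relaxation.
    (∀ k t : ℕ, 2 * t ≤ k → (Trap.OriginalBound (3 * f + 1) k t ↔
      (k : ℝ) + t < ((3 * f + 1 : ℕ) : ℝ) / 2)) ∧
    (∀ k t : ℕ, k ≤ 2 * t → (Trap.OriginalBound (3 * f + 1) k t ↔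
      (k : ℝ) + t < 2 * ((3 * f + 1 : ℕ) : ℝ) / 3 - t)) ∧
    (∀ k t : ℕ, Trap.OriginalBound (3 * f + 1) k t → Trap.RelaxedBound (3 * f + 1) k t) ∧
    -- The coalition sizes: from `C < n / 2` to `C < 5 n / 9`, a proper extension for `n ≥ 10`.
    (∀ C : ℕ, (∃ k t, k + t = C ∧ Trap.OriginalBound (3 * f + 1) k t) ↔
      (C : ℝ) < ((3 * f + 1 : ℕ) : ℝ) / 2) ∧
    (∀ C : ℕ, (∃ k t, k + t = C ∧ Trap.RelaxedBound (3 * f + 1) k t) ↔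
      (C : ℝ) < 5 * ((3 * f + 1 : ℕ) : ℝ) / 9) ∧
    (10 ≤ 3 * f + 1 → ∃ C : ℕ, ((3 * f + 1 : ℕ) : ℝ) / 2 ≤ C ∧
      (C : ℝ) < 5 * ((3 * f + 1 : ℕ) : ℝ) / 9) := by
  refine ⟨fun role pre s h a value S hS => ⟨hS.detectedEquivocators,
      hS.detectedEquivocators.subset_coalition h⟩,
    fun role pre => Trap.baitersAreCandidates,
    fun role pre s s' _ h p j c hcount hlate Q => h.card_le_of_late hcount hlate,
    fun k t => Trap.Window.tolerates,
    fun k t h => (Trap.relaxedBound_iff_window.1 h).1.tolerates,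
    fun C => Trap.le_window_iff, fun C hC => by omega,
    fun k t => Trap.relaxedBound_iff_window, fun k t hkt => ?_, fun k t hkt => ?_,
    -- The witness is `n / 2` rounded up. For odd `n` it needs `9 * (n + 1) < 10 * n`, hence `10 ≤
    -- n`.
    fun k t => ?_, fun C => ?_, fun C => ?_, fun hn => ⟨(3 * f + 2) / 2, ?_, ?_⟩⟩
  -- The sign of `k - 2 * t` decides which of `3 * k + 6 * t` and `4 * (k + t)` is larger, hence
  -- which half of the bound is binding.
  · rw [Trap.originalBound_iff, ← Nat.cast_add, Trap.cast_lt_half_iff]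
    omega
  · rw [Trap.originalBound_iff, Trap.add_lt_two_thirds_sub_iff]
    omega
  · rw [Trap.originalBound_iff, Trap.relaxedBound_iff]
    omega
  · simp only [Trap.originalBound_iff, Trap.cast_lt_half_iff]
    -- An all-rational coalition (`t = 0`) attains every admissible size.
    exact ⟨fun ⟨k, t, hC, h⟩ => by omega, fun h => ⟨C, 0, by omega⟩⟩
  · simp only [Trap.relaxedBound_iff, Trap.cast_lt_five_ninths_iff]
    exact ⟨fun ⟨k, t, hC, h⟩ => by omega, fun h => ⟨C, 0, by omega⟩⟩
  · rw [← not_lt, Trap.cast_lt_half_iff]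
    omega
  · rw [Trap.cast_lt_five_ninths_iff]
    omega
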